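/- Let $K$ be a field. For a finite connected simple graph $G$ and a subset $C$ of its vertices, let $\delta_C\in\{0,1\}^{E(G)}$ be the vector whose coordinate at an edge $e$ is $1$ if $|C\cap e|=1$ and $0$ otherwise. Let $A_G$ be the integer matrix whose columns are the vectors $(\delta,1)\in\mathbb{Z}^{E(G)}\times\mathbb{Z}$, one for each element $\delta$ of the set $\{\delta_C : C\subseteq V(G)\}$. The cut ideal $I_G$ is the toric ideal of $A_G$ over $K$, that is, the kernel of the $K$-algebra homomorphism from the polynomial ring over $K$ with one variable $x_\delta$ for each column to the ring of Laurent polynomials over $K$ with one indeterminate for each row, which sends $x_\delta$ to the Laurent monomial $\boldsymbol{t}^{(\delta,1)}$. **Proposition.** The cut ideal $I_{K_{2,3}}$ of the complete bipartite graph $K_{2,3}$ is generated by quadratic binomials, that is, by differences of two monomials of degree $2$. However, it has no lexicographic quadratic Gröbner basis: for no linear ordering of the $16$ variables does $I_{K_{2,3}}$ have, with respect to the induced lexicographic order, a Gröbner basis all of whose elements have degree $2$ (in particular, it has none consisting of quadratic binomials). -/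

import Mathlib

namespace CutIdeal

/-! ### Toric ideals -/

section Toric

/-- The toric ideal of an integer matrix `A` with columns indexed by `n`: the kernel of the
`K`-algebra homomorphism from `K[x_j : j ∈ n]` to the Laurent polynomial ring
`K[t_i^{±1} : i ∈ d]` (the group algebra of `ℤ^d`) that sends `x_j` to the Laurent monomial
whose exponent vector is the `j`-th column of `A`. -/
noncomputable def toricIdeal (K : Type*) [Field K] {d n : Type*} (A : Matrix d n ℤ) :
    Ideal (MvPolynomial n K) :=
  RingHom.ker (MvPolynomial.aeval (R := K)
    (fun j : n => (AddMonoidAlgebra.single (A.col j) 1 : AddMonoidAlgebra K (d → ℤ))))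

end Toric

/-! ### Cut ideals of graphs -/

section Cut

variable {V : Type*} [Fintype V] [DecidableEq V]

/-- The cut vector `δ_C ∈ {0,1}^E` of a set `C` of vertices: the coordinate at an edge `e` is `1`
if exactly one end of `e` lies in `C`, and `0` otherwise. -/
def cutVector (G : SimpleGraph V) (C : Finset V) (e : G.edgeSet) : ℤ :=
  if (C ∩ (e : Sym2 V).toFinset).card = 1 then 1 else 0

/-- The configuration `A_G`: its columns are the distinct cut vectors of `G`, each extended by an
additional last entry `1`. -/
def cutMatrix (G : SimpleGraph V) :
    Matrix (G.edgeSet ⊕ Unit) (Set.range (cutVector G)) ℤ :=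
  Matrix.of fun i δ => Sum.elim (δ : G.edgeSet → ℤ) (fun _ => 1) i

/-- The cut ideal of `G`: the toric ideal of `A_G`. Its ambient polynomial ring has one variable
for each cut vector. -/
noncomputable def cutIdeal (K : Type*) [Field K] (G : SimpleGraph V) :
    Ideal (MvPolynomial (Set.range (cutVector G)) K) :=
  toricIdeal K (cutMatrix G)

end Cut

/-! ### Quadratic binomials and Gröbner bases -/

section Groebner

variable {K : Type*} [Field K] {σ : Type*}

/-- A quadratic binomial: a difference of two different monomials of degree two. -/
def IsQuadraticBinomial (p : MvPolynomial σ K) : Prop :=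
  ∃ u v : σ →₀ ℕ, u ≠ v ∧ u.degree = 2 ∧ v.degree = 2 ∧
    p = MvPolynomial.monomial u 1 - MvPolynomial.monomial v 1

/-- The ideal is generated by a set of quadratic binomials. -/
def IsGeneratedByQuadraticBinomials (I : Ideal (MvPolynomial σ K)) : Prop :=
  ∃ S : Set (MvPolynomial σ K), (∀ p ∈ S, IsQuadraticBinomial p) ∧ Ideal.span S = I

/-- The initial ideal of `I`: the ideal generated by the leading terms of the elements of `I`. -/
noncomputable def initialIdeal (m : MonomialOrder σ) (I : Ideal (MvPolynomial σ K)) :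
    Ideal (MvPolynomial σ K) :=
  Ideal.span (m.leadingTerm '' (I : Set (MvPolynomial σ K)))

/-- `B` is a Gröbner basis of `I`: it is contained in `I` and its leading terms generate the
initial ideal of `I`. Finiteness of `B` is not required (in finitely many variables, every such
`B` contains a finite one). -/
def IsGroebnerBasis (m : MonomialOrder σ) (B : Set (MvPolynomial σ K))
    (I : Ideal (MvPolynomial σ K)) : Prop :=
  B ⊆ I ∧ Ideal.span (m.leadingTerm '' B) = initialIdeal m I

/-- `I` has a quadratic Gröbner basis for `m`: one all of whose elements have degree two. Every
Gröbner basis that consists of quadratic binomials is of this kind. -/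
def HasQuadraticGroebnerBasis (m : MonomialOrder σ) (I : Ideal (MvPolynomial σ K)) : Prop :=
  ∃ B : Set (MvPolynomial σ K), IsGroebnerBasis m B I ∧ ∀ g ∈ B, g.totalDegree = 2

/-- `I` has a lexicographic quadratic Gröbner basis: a quadratic one with respect to the
lexicographic order given by some linear order on the variables. -/
def HasLexQuadraticGroebnerBasis [Finite σ] (I : Ideal (MvPolynomial σ K)) : Prop :=
  ∃ _ : LinearOrder σ, HasQuadraticGroebnerBasis (MonomialOrder.lex (σ := σ)) I

end Groebner

end CutIdeal

/-!
The cuts of `K_{2,ι}` are the vertices of two cubes with a common centre, in complementary spaces: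
one for the cuts that separate the two vertices of the small side, one for the others.

Two kinds of quadratic moves connect all monomials in a fibre. Two factors in the same cube can
exchange a coordinate, and a pair of opposite vertices can be replaced by any other such pair,
since all these pairs have the same sum. If `u` and `v` lie in the same fibre and `u` has more
factors in one cube than `v`, then `u` has factors on every facet of this cube, so that exchanges
of coordinates produce a pair of opposite vertices, which is then moved to the other cube; if the
numbers agree, exchanges alone lead from `u` to any given factor of `v`.

For a lexicographic order, let `b * b'` be the least product of two opposite vertices and let `w`
be the greatest variable of the cube that does not contain `b`. When `3 ≤ |ι|`, three vertices
other than `w` of the cube of `w` sum to `w`, so `w * b * b'` lies in the initial ideal; but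
none of its divisors of degree two does, because `w * b` and `w * b'` are alone in their fibres.
-/

namespace CutIdeal

section Exponents

variable {σ : Type*}

theorem exists_eq_add_single {u : σ →₀ ℕ} {i : σ} (h : u i ≠ 0) :
    ∃ r, u = r + Finsupp.single i 1 :=
  le_iff_exists_add'.1 (Finsupp.single_le_iff.2 (Nat.one_le_iff_ne_zero.2 h))

theorem exists_eq_single_add_single_of_degree_eq_two {u : σ →₀ ℕ} (h : u.degree = 2) :
    ∃ i j, u = Finsupp.single i 1 + Finsupp.single j 1 := by
  classical
  obtain ⟨i, j, hij⟩ : ∃ i j, u.toMultiset = {i, j} :=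
    Multiset.card_eq_two.1 ((Finsupp.card_toMultiset u).trans h)
  refine ⟨i, j, Multiset.toFinsupp.symm.injective ?_⟩
  simpa using hij

theorem le_add_single_of_degree_le_two {u : σ →₀ ℕ} {i j k : σ} (hdeg : u.degree ≤ 2)
    (hu : u ≤ Finsupp.single i 1 + Finsupp.single j 1 + Finsupp.single k 1) :
    u ≤ Finsupp.single i 1 + Finsupp.single j 1 ∨ u ≤ Finsupp.single i 1 + Finsupp.single k 1 ∨
      u ≤ Finsupp.single j 1 + Finsupp.single k 1 := by
  obtain ⟨r, hr⟩ := exists_add_of_le hu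
  have hr0 : r ≠ 0 := by
    rintro rfl
    have h3 : 3 = u.degree := by simpa using congrArg Finsupp.degree hr
    omega
  obtain ⟨l, hl⟩ := Finsupp.ne_iff.1 hr0
  obtain ⟨r, rfl⟩ := exists_eq_add_single hl
  have hl : l = i ∨ l = j ∨ l = k := by
    by_contra! hne
    have := DFunLike.congr_fun hr l
    simp [Finsupp.single_eq_of_ne, hne] at this
  rw [← add_assoc] at hr
  rcases hl with rfl | rfl | rfl
  · exact .inr (.inr (le_of_add_le_add_right (a := Finsupp.single l 1) (by
      rw [add_right_comm, add_comm (Finsupp.single j 1), hr]; gcongr; simp)))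
  · exact .inr (.inl (le_of_add_le_add_right (a := Finsupp.single l 1) (by
      rw [add_right_comm, hr]; gcongr; simp)))
  · exact .inl (le_of_add_le_add_right (a := Finsupp.single l 1) (by rw [hr]; gcongr; simp))

/-- By induction on the degree: a common variable can be cancelled from both vectors. -/
theorem addCon_of_exists_common_variable {M : Type*} [AddCancelCommMonoid M]
    {φ : (σ →₀ ℕ) →+ M} {C : AddCon (σ →₀ ℕ)} (hC : C ≤ AddCon.ker φ)
    (hφ : ∀ u v, φ u = φ v → u.degree = v.degree)
    (hcommon : ∀ u v, φ u = φ v → v ≠ 0 → ∃ u' i, C u u' ∧ u' i ≠ 0 ∧ v i ≠ 0)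
    {u v : σ →₀ ℕ} (huv : φ u = φ v) : C u v := by
  induction hN : v.degree generalizing u v with
  | zero =>
    have hu := (hφ u v huv).trans hN
    rw [(Finsupp.degree_eq_zero_iff _).1 hu, (Finsupp.degree_eq_zero_iff _).1 hN]
    exact C.refl 0
  | succ N ih =>
    have hv : v ≠ 0 := by
      rintro rfl
      simp at hN
    obtain ⟨u', i, huu', hu'i, hvi⟩ := hcommon u v huv hv
    obtain ⟨a, rfl⟩ := exists_eq_add_single hu'i
    obtain ⟨b, rfl⟩ := exists_eq_add_single hvi
    have hab : φ a = φ b := by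
      have hker : φ u = φ (a + Finsupp.single i 1) := hC huu'
      rw [hker, map_add, map_add] at huv
      exact add_right_cancel huv
    have hbN : b.degree = N := by simpa using hN
    exact C.trans huu' (C.add (ih hab hbN) (C.refl _))

end Exponents

section AdditiveMaps

variable {σ M : Type*} [AddCommMonoid M]

theorem map_eq_sum_nsmul_single (φ : (σ →₀ ℕ) →+ M) (u : σ →₀ ℕ) :
    φ u = u.sum fun i k => k • φ (Finsupp.single i 1) := by
  conv_lhs => rw [← u.sum_single, map_finsuppSum]
  simp only [← map_nsmul, Finsupp.smul_single, smul_eq_mul, mul_one]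

theorem exists_single_ne_zero_of_map_ne_zero {φ : (σ →₀ ℕ) →+ M} {u : σ →₀ ℕ} (hu : φ u ≠ 0) :
    ∃ i, u i ≠ 0 ∧ φ (Finsupp.single i 1) ≠ 0 := by
  rw [map_eq_sum_nsmul_single] at hu
  obtain ⟨i, hi, hne⟩ := Finset.exists_ne_zero_of_sum_ne_zero hu
  exact ⟨i, Finsupp.mem_support_iff.1 hi, right_ne_zero_of_smul hne⟩

theorem map_nonneg_of_single_nonneg [PartialOrder M] [IsOrderedAddMonoid M] {φ : (σ →₀ ℕ) →+ M}
    (hφ : ∀ i, 0 ≤ φ (Finsupp.single i 1)) (u : σ →₀ ℕ) : 0 ≤ φ u := by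
  rw [map_eq_sum_nsmul_single]
  exact Finset.sum_nonneg fun i _ => nsmul_nonneg (hφ i) _

theorem exists_single_pos_of_map_pos [LinearOrder M] [IsOrderedAddMonoid M] {φ : (σ →₀ ℕ) →+ M}
    {u : σ →₀ ℕ} (hu : 0 < φ u) : ∃ i, u i ≠ 0 ∧ 0 < φ (Finsupp.single i 1) := by
  by_contra! h
  rw [map_eq_sum_nsmul_single] at hu
  exact hu.not_ge (Finset.sum_nonpos fun i hi =>
    nsmul_nonpos (h i (Finsupp.mem_support_iff.1 hi)) _)

end AdditiveMaps

section Toric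

variable {K : Type*} [Field K] {d n : Type*} {A : Matrix d n ℤ}

/-- The exponent vector of the Laurent monomial to which the parametrization by the columns of `A`
sends the monomial with exponent vector `u`. The fibres of this map are the fibres of the toric
ideal of `A`. -/
noncomputable def multidegree (A : Matrix d n ℤ) : (n →₀ ℕ) →+ (d → ℤ) :=
  Finsupp.weight A.col

variable (K A) in
/-- The monomial parametrization whose kernel is the toric ideal of `A`. -/
noncomputable def laurentHom : MvPolynomial n K →ₐ[K] AddMonoidAlgebra K (d → ℤ) :=
  MvPolynomial.aeval fun j => AddMonoidAlgebra.single (A.col j) 1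

theorem mem_toricIdeal {f : MvPolynomial n K} : f ∈ toricIdeal K A ↔ laurentHom K A f = 0 :=
  Iff.rfl

theorem multidegree_apply (u : n →₀ ℕ) (r : d) :
    multidegree A u r = Finsupp.weight (A r) u := by
  simp [multidegree, Finsupp.weight_apply, Finsupp.sum]

theorem laurentHom_monomial (u : n →₀ ℕ) (a : K) :
    laurentHom K A (MvPolynomial.monomial u a) =
      AddMonoidAlgebra.single (multidegree A u) a := by
  rw [laurentHom, MvPolynomial.aeval_monomial]
  simp only [AddMonoidAlgebra.single_pow, one_pow]
  simp [Finsupp.prod, AddMonoidAlgebra.prod_single, multidegree, Finsupp.weight_apply, Finsupp.sum]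

theorem monomial_sub_monomial_mem_toricIdeal {u v : n →₀ ℕ}
    (h : multidegree A u = multidegree A v) :
    MvPolynomial.monomial u (1 : K) - MvPolynomial.monomial v 1 ∈ toricIdeal K A := by
  rw [mem_toricIdeal, map_sub, laurentHom_monomial, laurentHom_monomial, h, sub_self]

theorem exists_mem_support_ne_of_mem_toricIdeal {f : MvPolynomial n K} (hf : f ∈ toricIdeal K A)
    {u : n →₀ ℕ} (hu : u ∈ f.support) :
    ∃ v ∈ f.support, v ≠ u ∧ multidegree A v = multidegree A u := by
  by_contra! hne
  rw [mem_toricIdeal, f.as_sum, map_sum] at hf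
  have hcoeff := congrArg (fun g => g.coeff (multidegree A u)) hf
  simp only [laurentHom_monomial, AddMonoidAlgebra.coeff_sum, AddMonoidAlgebra.coeff_single,
    Finsupp.finsetSum_apply, AddMonoidAlgebra.coeff_zero, Finsupp.coe_zero, Pi.zero_apply] at hcoeff
  rw [Finset.sum_eq_single_of_mem u hu
    (fun v hv hvu => Finsupp.single_eq_of_ne (hne v hv hvu).symm), Finsupp.single_eq_same] at hcoeff
  exact MvPolynomial.mem_support_iff.1 hu hcoeff

theorem toricIdeal_le {J : Ideal (MvPolynomial n K)}
    (hJ : ∀ u v, multidegree A u = multidegree A v →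
      MvPolynomial.monomial u (1 : K) - MvPolynomial.monomial v 1 ∈ J) :
    toricIdeal K A ≤ J := by
  let rep : (d → ℤ) → (n →₀ ℕ) := Function.invFun (multidegree A)
  have hrep (f : MvPolynomial n K) :
      f - (AddMonoidAlgebra.mapDomain rep (laurentHom K A f) : AddMonoidAlgebra K _) ∈ J := by
    induction f using MvPolynomial.induction_on' with
    | monomial u a =>
      rw [laurentHom_monomial, AddMonoidAlgebra.mapDomain_single]
      have := J.mul_mem_left (MvPolynomial.C a)
        (hJ u (rep (multidegree A u)) (Function.invFun_eq ⟨u, rfl⟩).symm)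
      rwa [mul_sub, MvPolynomial.C_mul_monomial, MvPolynomial.C_mul_monomial, mul_one] at this
    | add p q hp hq =>
      rw [map_add, AddMonoidAlgebra.mapDomain_add]
      have := J.add_mem hp hq
      rwa [← add_sub_add_comm] at this
  intro f hf
  have := hrep f
  rw [mem_toricIdeal] at hf
  rw [hf, AddMonoidAlgebra.mapDomain_zero] at this
  exact (sub_zero f) ▸ this

end Toric

section StandardMonomials

variable {K : Type*} [Field K] {d n : Type*} {A : Matrix d n ℤ} {m : MonomialOrder n}

variable (A m) in
/-- The monomial with exponent vector `u` is standard for the toric ideal of `A`, that is, outside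
its initial ideal. This is phrased without the ideal: `u` is the least vector of its fibre. -/
def IsStandard (u : n →₀ ℕ) : Prop :=
  ∀ v, multidegree A v = multidegree A u → m.toSyn u ≤ m.toSyn v

theorem IsStandard.of_le {a u : n →₀ ℕ} (hu : IsStandard A m u) (hau : a ≤ u) :
    IsStandard A m a := by
  obtain ⟨r, rfl⟩ := exists_add_of_le hau
  intro b hb
  have := hu (b + r) (by rw [map_add, map_add, hb])
  rwa [map_add, map_add, add_le_add_iff_right] at this

theorem not_isStandard_degree {f : MvPolynomial n K} (hf : f ∈ toricIdeal K A) (hf0 : f ≠ 0) :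
    ¬ IsStandard A m (m.degree f) := by
  obtain ⟨v, hv, hne, hvA⟩ :=
    exists_mem_support_ne_of_mem_toricIdeal hf (m.degree_mem_support hf0)
  intro hstd
  exact hne (m.toSyn.injective ((m.le_degree hv).antisymm (hstd v hvA)))

theorem monomial_mem_initialIdeal_of_not_isStandard {u : n →₀ ℕ} (hu : ¬ IsStandard A m u) :
    MvPolynomial.monomial u (1 : K) ∈ initialIdeal m (toricIdeal K A) := by
  classical
  obtain ⟨v, hvA, hlt⟩ : ∃ v, multidegree A v = multidegree A u ∧ m.toSyn v < m.toSyn u := by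
    simpa only [IsStandard, not_forall, not_le, exists_prop] using hu
  refine Ideal.subset_span ⟨_, monomial_sub_monomial_mem_toricIdeal hvA.symm, ?_⟩
  have hdeg : m.toSyn (m.degree (MvPolynomial.monomial v (1 : K)))
      < m.toSyn (m.degree (MvPolynomial.monomial u (1 : K))) := by
    simpa [MonomialOrder.degree_monomial] using hlt
  rw [MonomialOrder.leadingTerm, m.leadingCoeff_sub_of_lt hdeg, m.degree_sub_of_lt hdeg,
    m.degree_monomial, if_neg one_ne_zero, m.leadingCoeff_monomial]

theorem exists_degree_le_of_monomial_mem_span_leadingTerm {B : Set (MvPolynomial n K)}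
    {u : n →₀ ℕ} (hu : MvPolynomial.monomial u (1 : K) ∈ Ideal.span (m.leadingTerm '' B)) :
    ∃ g ∈ B, g ≠ 0 ∧ m.degree g ≤ u := by
  rw [m.span_leadingTerm_eq_span_monomial',
    ← Set.image_image (fun i => MvPolynomial.monomial i 1) m.degree,
    MvPolynomial.mem_ideal_span_monomial_image] at hu
  classical
  obtain ⟨_, ⟨g, ⟨hgB, hg0⟩, rfl⟩, hle⟩ := hu u (by simp [MvPolynomial.coeff_monomial])
  exact ⟨g, hgB, hg0, hle⟩

theorem HasQuadraticGroebnerBasis.isStandard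
    (hB : HasQuadraticGroebnerBasis m (toricIdeal K A)) {u : n →₀ ℕ}
    (hu : ∀ a ≤ u, a.degree ≤ 2 → IsStandard A m a) : IsStandard A m u := by
  obtain ⟨B, ⟨hBI, hspan⟩, hdeg⟩ := hB
  by_contra hnot
  have hmem := monomial_mem_initialIdeal_of_not_isStandard (K := K) hnot
  rw [← hspan] at hmem
  obtain ⟨g, hgB, hg0, hgu⟩ := exists_degree_le_of_monomial_mem_span_leadingTerm hmem
  have hg2 : (m.degree g).degree ≤ 2 :=
    (MvPolynomial.le_totalDegree (m.degree_mem_support hg0)).trans_eq (hdeg g hgB)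
  exact not_isStandard_degree (hBI hgB) hg0 (hu _ hgu hg2)

end StandardMonomials

section QuadraticMoves

variable {K : Type*} [Field K] {d n : Type*} {A : Matrix d n ℤ}

/-- The congruence on exponent vectors generated by the quadratic moves of `A`, which replace a
product of two variables by another one in the same fibre. -/
noncomputable def quadraticMoves (A : Matrix d n ℤ) : AddCon (n →₀ ℕ) :=
  addConGen fun u v => u.degree = 2 ∧ v.degree = 2 ∧ multidegree A u = multidegree A v

theorem quadraticMoves_of_degree_eq_two {u v : n →₀ ℕ} (hu : u.degree = 2) (hv : v.degree = 2)
    (h : multidegree A u = multidegree A v) : quadraticMoves A u v :=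
  AddConGen.Rel.of _ _ ⟨hu, hv, h⟩

theorem quadraticMoves_le_ker : quadraticMoves A ≤ AddCon.ker (multidegree A) :=
  AddCon.addConGen_le.2 fun _ _ h => (AddCon.ker_rel _).2 h.2.2

/-- The congruence on exponent vectors whose classes are the monomials that agree modulo `J`. -/
noncomputable def monomialCon (J : Ideal (MvPolynomial n K)) : AddCon (n →₀ ℕ) where
  r u v := MvPolynomial.monomial u (1 : K) - MvPolynomial.monomial v 1 ∈ J
  iseqv :=
    { refl := fun _ => by rw [sub_self]; exact J.zero_mem
      symm := fun h => by rw [← neg_sub]; exact J.neg_mem h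
      trans := fun h h' => by rw [← sub_add_sub_cancel]; exact J.add_mem h h' }
  add' {a b c d} h h' := by
    have := J.add_mem (J.mul_mem_right (MvPolynomial.monomial c 1) h)
      (J.mul_mem_left (MvPolynomial.monomial b 1) h')
    simpa [sub_mul, mul_sub, MvPolynomial.monomial_mul] using this

theorem isGeneratedByQuadraticBinomials_toricIdeal
    (h : ∀ u v, multidegree A u = multidegree A v → quadraticMoves A u v) :
    IsGeneratedByQuadraticBinomials (toricIdeal K A) := by
  let S : Set (MvPolynomial n K) := {p | IsQuadraticBinomial p ∧ p ∈ toricIdeal K A}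
  have hS : quadraticMoves A ≤ monomialCon (Ideal.span S) := by
    refine AddCon.addConGen_le.2 fun u v ⟨hu, hv, huv⟩ => ?_
    rcases eq_or_ne u v with rfl | hne
    · exact (monomialCon _).refl u
    · exact Ideal.subset_span
        ⟨⟨u, v, hne, hu, hv, rfl⟩, monomial_sub_monomial_mem_toricIdeal huv⟩
  exact ⟨S, fun _ hp => hp.1, (Ideal.span_le.2 fun _ hp => hp.2).antisymm
    (toricIdeal_le fun u v huv => hS (h u v huv))⟩

end QuadraticMoves

section TwoCubes

variable {d n ι : Type*} {A : Matrix d n ℤ}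

/-- The number of factors of a monomial in the cube `s`, where the variables are indexed by the
vertices `(s, x)` of two cubes with side label `s = ±1` and coordinates `x j = ±1`. -/
noncomputable def cubeDegree (c : ℤˣ × (ι → ℤˣ) ≃ n) (s : ℤˣ) : (n →₀ ℕ) →+ ℤ :=
  Finsupp.weight fun k => if (c.symm k).1 = s then 1 else 0

/-- The sum of the `j`-th coordinates of the factors of a monomial in the cube `s`. -/
noncomputable def cubeMoment (c : ℤˣ × (ι → ℤˣ) ≃ n) (s : ℤˣ) (j : ι) : (n →₀ ℕ) →+ ℤ :=
  Finsupp.weight fun k => if (c.symm k).1 = s then ((c.symm k).2 j : ℤ) else 0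

/-- Twice the number of factors of a monomial on the facet `x j = β` of the cube `s`. -/
noncomputable def facetDegree (c : ℤˣ × (ι → ℤˣ) ≃ n) (s : ℤˣ) (j : ι) (β : ℤˣ) :
    (n →₀ ℕ) →+ ℤ :=
  cubeDegree c s + (AddMonoidHom.mulLeft (β : ℤ)).comp (cubeMoment c s j)

/-- In suitable coordinates, the columns of `A` are the vertices of two cubes that lie in
complementary spaces and have the same centre. This is expressed through the fibres of `A`: the
monomials in a fibre share their degree and, for each cube, the coordinate sums of their factors
in it. -/
def IsTwoCubes (A : Matrix d n ℤ) (c : ℤˣ × (ι → ℤˣ) ≃ n) : Prop :=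
  ∀ u v, multidegree A u = multidegree A v ↔
    u.degree = v.degree ∧ ∀ s j, cubeMoment c s j u = cubeMoment c s j v

variable {c : ℤˣ × (ι → ℤˣ) ≃ n}

theorem cubeDegree_single (s t : ℤˣ) (x : ι → ℤˣ) :
    cubeDegree c s (Finsupp.single (c (t, x)) 1) = if t = s then 1 else 0 := by
  simp [cubeDegree, Finsupp.weight_apply]

theorem cubeMoment_single (s t : ℤˣ) (j : ι) (x : ι → ℤˣ) :
    cubeMoment c s j (Finsupp.single (c (t, x)) 1) = if t = s then (x j : ℤ) else 0 := by
  simp [cubeMoment, Finsupp.weight_apply]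

theorem facetDegree_apply (s : ℤˣ) (j : ι) (β : ℤˣ) (u : n →₀ ℕ) :
    facetDegree c s j β u = cubeDegree c s u + β * cubeMoment c s j u :=
  rfl

theorem facetDegree_single (s t : ℤˣ) (j : ι) (β : ℤˣ) (x : ι → ℤˣ) :
    facetDegree c s j β (Finsupp.single (c (t, x)) 1) = if t = s ∧ x j = β then 2 else 0 := by
  rw [facetDegree_apply, cubeDegree_single, cubeMoment_single]
  rcases Int.units_eq_one_or (x j) with hx | hx <;> rcases Int.units_eq_one_or β with rfl | rfl <;>
    by_cases ht : t = s <;> simp [hx, ht]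

theorem cubeDegree_nonneg (s : ℤˣ) (u : n →₀ ℕ) : 0 ≤ cubeDegree c s u := by
  refine map_nonneg_of_single_nonneg (c.surjective.forall.2 fun ⟨t, x⟩ => ?_) u
  rw [cubeDegree_single]
  split_ifs <;> norm_num

theorem facetDegree_nonneg (s : ℤˣ) (j : ι) (β : ℤˣ) (u : n →₀ ℕ) :
    0 ≤ facetDegree c s j β u := by
  refine map_nonneg_of_single_nonneg (c.surjective.forall.2 fun ⟨t, x⟩ => ?_) u
  rw [facetDegree_single]
  split_ifs <;> norm_num

theorem facetDegree_pos {s : ℤˣ} {x : ι → ℤˣ} {u : n →₀ ℕ} (h : u (c (s, x)) ≠ 0) (j : ι) :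
    0 < facetDegree c s j (x j) u := by
  obtain ⟨r, rfl⟩ := exists_eq_add_single h
  have := facetDegree_nonneg (c := c) s j (x j) r
  rw [map_add, facetDegree_single, if_pos ⟨rfl, rfl⟩]
  omega

theorem exists_of_facetDegree_pos {s β : ℤˣ} {j : ι} {u : n →₀ ℕ}
    (h : 0 < facetDegree c s j β u) : ∃ x, x j = β ∧ u (c (s, x)) ≠ 0 := by
  obtain ⟨i, hi, hpos⟩ := exists_single_pos_of_map_pos h
  obtain ⟨⟨t, x⟩, rfl⟩ := c.surjective i
  rw [facetDegree_single] at hpos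
  obtain ⟨⟨rfl, hx⟩, -⟩ := ite_ne_right_iff.1 hpos.ne'
  exact ⟨x, hx, hi⟩

theorem exists_of_cubeDegree_pos {s : ℤˣ} {u : n →₀ ℕ} (h : 0 < cubeDegree c s u) :
    ∃ x, u (c (s, x)) ≠ 0 := by
  obtain ⟨i, hi, hpos⟩ := exists_single_pos_of_map_pos h
  obtain ⟨⟨t, x⟩, rfl⟩ := c.surjective i
  rw [cubeDegree_single] at hpos
  obtain ⟨rfl, -⟩ := ite_ne_right_iff.1 hpos.ne'
  exact ⟨x, hi⟩

theorem natCast_degree_eq (c : ℤˣ × (ι → ℤˣ) ≃ n) (s : ℤˣ) (u : n →₀ ℕ) :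
    (u.degree : ℤ) = cubeDegree c s u + cubeDegree c (-s) u := by
  have h : (Nat.castAddMonoidHom ℤ).comp Finsupp.degree =
      cubeDegree c s + cubeDegree c (-s) := by
    refine Finsupp.addHom_ext' fun i => AddMonoidHom.ext_nat ?_
    obtain ⟨⟨t, x⟩, rfl⟩ := c.surjective i
    rcases Int.units_eq_one_or s with rfl | rfl <;> rcases Int.units_eq_one_or t with rfl | rfl <;>
      simp [cubeDegree_single]
  exact DFunLike.congr_fun h u

variable (A c) in
/-- The quadratic moves that keep the number of factors in the cube `s`. -/
noncomputable def cubeMoves (s : ℤˣ) : AddCon (n →₀ ℕ) :=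
  quadraticMoves A ⊓ AddCon.ker (cubeDegree c s)

theorem IsTwoCubes.facetDegree_eq (hA : IsTwoCubes A c) {s : ℤˣ} {u v : n →₀ ℕ}
    (h : cubeMoves A c s u v) (j : ι) (β : ℤˣ) :
    facetDegree c s j β u = facetDegree c s j β v := by
  have hdeg : cubeDegree c s u = cubeDegree c s v := h.2
  have hmul : multidegree A u = multidegree A v := quadraticMoves_le_ker h.1
  rw [facetDegree_apply, facetDegree_apply, hdeg, ((hA u v).1 hmul).2]

theorem IsTwoCubes.cubeMoves_swap [DecidableEq ι] (hA : IsTwoCubes A c) (s : ℤˣ) (j : ι)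
    (y z : ι → ℤˣ) :
    cubeMoves A c s (Finsupp.single (c (s, y)) 1 + Finsupp.single (c (s, z)) 1)
      (Finsupp.single (c (s, Function.update y j (z j))) 1 +
        Finsupp.single (c (s, Function.update z j (y j))) 1) := by
  refine ⟨quadraticMoves_of_degree_eq_two (by simp) (by simp)
    ((hA _ _).2 ⟨by simp, fun t k => ?_⟩), (AddCon.ker_rel _).2 ?_⟩
  · simp only [map_add, cubeMoment_single]
    rcases eq_or_ne k j with rfl | hk
    · simp only [Function.update_self, add_comm]
    · simp only [Function.update_of_ne hk]
  · simp only [map_add, cubeDegree_single]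

theorem IsTwoCubes.exists_cubeMoves_update [DecidableEq ι] (hA : IsTwoCubes A c) {s : ℤˣ}
    {y z : ι → ℤˣ} {u : n →₀ ℕ} (hy : u (c (s, y)) ≠ 0) (hz : u (c (s, z)) ≠ 0) (j : ι) :
    ∃ v, cubeMoves A c s u v ∧ v (c (s, Function.update y j (z j))) ≠ 0 := by
  rcases eq_or_ne y z with rfl | hyz
  · exact ⟨u, AddCon.refl _ u, by rwa [Function.update_eq_self]⟩
  obtain ⟨r, rfl⟩ := exists_eq_add_single hz
  have hne : c (s, y) ≠ c (s, z) := by simpa using hyz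
  rw [Finsupp.add_apply, Finsupp.single_eq_of_ne hne, add_zero] at hy
  obtain ⟨r, rfl⟩ := exists_eq_add_single hy
  rw [add_assoc]
  exact ⟨_, AddCon.add _ (AddCon.refl _ r) (hA.cubeMoves_swap s j y z), by simp⟩

/-- The vertex is reached by correcting the coordinates one after the other. -/
theorem IsTwoCubes.exists_cubeMoves_vertex [Finite ι] [Nonempty ι] (hA : IsTwoCubes A c) {s : ℤˣ}
    {x : ι → ℤˣ} {u : n →₀ ℕ} (h : ∀ j, 0 < facetDegree c s j (x j) u) :
    ∃ v, cubeMoves A c s u v ∧ v (c (s, x)) ≠ 0 := by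
  classical
  have := Fintype.ofFinite ι
  suffices H : ∀ T : Finset ι, ∃ v y, cubeMoves A c s u v ∧ v (c (s, y)) ≠ 0 ∧
      ∀ j ∈ T, y j = x j by
    obtain ⟨v, y, huv, hv, hyx⟩ := H Finset.univ
    obtain rfl : y = x := funext fun j => hyx j (Finset.mem_univ j)
    exact ⟨v, huv, hv⟩
  intro T
  induction T using Finset.induction_on with
  | empty =>
    obtain ⟨y, -, hy⟩ := exists_of_facetDegree_pos (h (Classical.arbitrary ι))
    exact ⟨u, y, AddCon.refl _ u, hy, by simp⟩
  | insert j T hj ih =>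
    obtain ⟨v, y, huv, hv, hyx⟩ := ih
    obtain ⟨z, hzj, hz⟩ := exists_of_facetDegree_pos ((h j).trans_eq (hA.facetDegree_eq huv j _))
    obtain ⟨v', hvv', hv'⟩ := hA.exists_cubeMoves_update hv hz j
    refine ⟨v', _, AddCon.trans _ huv hvv', hv', (Finset.forall_mem_insert _ _ _).2 ⟨?_, ?_⟩⟩
    · rw [Function.update_self, hzj]
    · exact fun k hk => (Function.update_of_ne (ne_of_mem_of_not_mem hk hj) _ _).trans (hyx k hk)

variable (c) in
/-- The product of the variables of two opposite vertices of a cube. -/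
noncomputable def antipodalPair (i : ℤˣ × (ι → ℤˣ)) : n →₀ ℕ :=
  Finsupp.single (c i) 1 + Finsupp.single (c (i.1, -i.2)) 1

theorem degree_antipodalPair (i : ℤˣ × (ι → ℤˣ)) : (antipodalPair c i).degree = 2 := by
  simp [antipodalPair]

theorem cubeMoment_antipodalPair (i : ℤˣ × (ι → ℤˣ)) (s : ℤˣ) (j : ι) :
    cubeMoment c s j (antipodalPair c i) = 0 := by
  obtain ⟨t, x⟩ := i
  simp only [antipodalPair, map_add, cubeMoment_single, Pi.neg_apply, Units.val_neg]
  split_ifs <;> simp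

theorem IsTwoCubes.multidegree_antipodalPair (hA : IsTwoCubes A c) (i k : ℤˣ × (ι → ℤˣ)) :
    multidegree A (antipodalPair c i) = multidegree A (antipodalPair c k) :=
  (hA _ _).2 ⟨by simp only [degree_antipodalPair],
    fun s j => by simp only [cubeMoment_antipodalPair]⟩

theorem IsTwoCubes.exists_quadraticMoves_antipodalPair [Finite ι] [Nonempty ι]
    (hA : IsTwoCubes A c) {s : ℤˣ} {u : n →₀ ℕ} (h : ∀ j β, 0 < facetDegree c s j β u)
    (i : ℤˣ × (ι → ℤˣ)) : ∃ r, quadraticMoves A u (r + antipodalPair c i) := by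
  obtain ⟨v, huv, hv⟩ := hA.exists_cubeMoves_vertex (x := 1) fun j => h j _
  obtain ⟨r, rfl⟩ := exists_eq_add_single hv
  have hr (j : ι) : 0 < facetDegree c s j ((-1 : ι → ℤˣ) j) r := by
    have := h j (-1)
    rw [hA.facetDegree_eq huv, map_add, facetDegree_single] at this
    simpa using this
  obtain ⟨w, hrw, hw⟩ := hA.exists_cubeMoves_vertex hr
  obtain ⟨r', rfl⟩ := exists_eq_add_single hw
  have hpair : quadraticMoves A (antipodalPair c (s, 1)) (antipodalPair c i) :=
    quadraticMoves_of_degree_eq_two (degree_antipodalPair _) (degree_antipodalPair _)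
      (hA.multidegree_antipodalPair _ _)
  refine ⟨r', AddCon.trans _ huv.1 (AddCon.trans _ (AddCon.add _ hrw.1 (AddCon.refl _ _)) ?_)⟩
  rw [add_assoc, add_comm (Finsupp.single _ 1)]
  exact AddCon.add _ (AddCon.refl _ r') hpair

theorem IsTwoCubes.exists_common_variable [Finite ι] [Nonempty ι] (hA : IsTwoCubes A c)
    {u v : n →₀ ℕ} (huv : multidegree A u = multidegree A v) (hv : v ≠ 0) :
    ∃ u' i, quadraticMoves A u u' ∧ u' i ≠ 0 ∧ v i ≠ 0 := by
  obtain ⟨hdeg, hmoment⟩ := (hA u v).1 huv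
  have hsum (s : ℤˣ) : cubeDegree c s u + cubeDegree c (-s) u =
      cubeDegree c s v + cubeDegree c (-s) v := by
    rw [← natCast_degree_eq, ← natCast_degree_eq, hdeg]
  have hfacet (s : ℤˣ) (j : ι) (β : ℤˣ) : facetDegree c s j β u - cubeDegree c s u =
      facetDegree c s j β v - cubeDegree c s v := by
    simp only [facetDegree_apply, hmoment, add_sub_cancel_left]
  by_cases hlt : ∃ s, cubeDegree c s v < cubeDegree c s u
  · obtain ⟨s, hs⟩ := hlt
    have hpos (j : ι) (β : ℤˣ) : 0 < facetDegree c s j β u := by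
      have := facetDegree_nonneg (c := c) s j β v
      have := hfacet s j β
      omega
    obtain ⟨y, hy⟩ : ∃ y, v (c (-s, y)) ≠ 0 := by
      refine exists_of_cubeDegree_pos ?_
      have := cubeDegree_nonneg (c := c) (-s) u
      have := hsum s
      omega
    obtain ⟨r, hr⟩ := hA.exists_quadraticMoves_antipodalPair hpos (-s, y)
    exact ⟨_, c (-s, y), hr, by simp [antipodalPair], hy⟩
  · push Not at hlt
    obtain ⟨i, hi⟩ := Finsupp.ne_iff.1 hv
    obtain ⟨⟨s, x⟩, rfl⟩ := c.surjective i
    have heq : cubeDegree c s u = cubeDegree c s v := by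
      have := hlt s
      have := hlt (-s)
      have := hsum s
      omega
    obtain ⟨u', hu', hx⟩ := hA.exists_cubeMoves_vertex (s := s) (x := x) (u := u) fun j => by
      have := facetDegree_pos hi j
      have := hfacet s j (x j)
      omega
    exact ⟨u', _, hu'.1, hx, hi⟩

theorem IsTwoCubes.isGeneratedByQuadraticBinomials [Finite ι] [Nonempty ι] (K : Type*) [Field K]
    (hA : IsTwoCubes A c) : IsGeneratedByQuadraticBinomials (toricIdeal K A) :=
  isGeneratedByQuadraticBinomials_toricIdeal fun _ _ =>
    addCon_of_exists_common_variable quadraticMoves_le_ker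
      (fun u v huv => ((hA u v).1 huv).1) fun _ _ => hA.exists_common_variable

end TwoCubes

section LexOrder

variable {d n ι : Type*} {A : Matrix d n ℤ} {c : ℤˣ × (ι → ℤˣ) ≃ n}

theorem IsTwoCubes.eq_antipodalPair [Nonempty ι] (hA : IsTwoCubes A c) {i : ℤˣ × (ι → ℤˣ)}
    {u : n →₀ ℕ} (h : multidegree A u = multidegree A (antipodalPair c i)) :
    ∃ k, u = antipodalPair c k := by
  obtain ⟨hdeg, hmoment⟩ := (hA _ _).1 h
  obtain ⟨k, l, rfl⟩ :=
    exists_eq_single_add_single_of_degree_eq_two (hdeg.trans (degree_antipodalPair i))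
  obtain ⟨⟨s, x⟩, rfl⟩ := c.surjective k
  obtain ⟨⟨t, y⟩, rfl⟩ := c.surjective l
  have hsum (j : ι) : (x j : ℤ) + (if t = s then (y j : ℤ) else 0) = 0 := by
    simpa only [map_add, cubeMoment_single, if_true, cubeMoment_antipodalPair] using hmoment s j
  obtain rfl : t = s := by
    by_contra hts
    have := hsum (Classical.arbitrary ι)
    simp [hts] at this
  obtain rfl : y = -x := by
    funext j
    have := hsum j
    rw [if_pos rfl] at this
    exact Units.ext (by rw [Pi.neg_apply, Units.val_neg]; omega)
  exact ⟨(t, x), rfl⟩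

theorem exists_of_cubeMoment_ne_zero {s : ℤˣ} {j : ι} {u : n →₀ ℕ}
    (h : cubeMoment c s j u ≠ 0) : ∃ x, u (c (s, x)) ≠ 0 := by
  obtain ⟨i, hi, hne⟩ := exists_single_ne_zero_of_map_ne_zero h
  obtain ⟨⟨t, x⟩, rfl⟩ := c.surjective i
  rw [cubeMoment_single] at hne
  obtain ⟨rfl, -⟩ := ite_ne_right_iff.1 hne
  exact ⟨x, hi⟩

theorem IsTwoCubes.eq_of_multidegree_eq_mixed [Nonempty ι] (hA : IsTwoCubes A c) {s t : ℤˣ}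
    {x y : ι → ℤˣ} (hst : s ≠ t) {u : n →₀ ℕ} (h : multidegree A u =
      multidegree A (Finsupp.single (c (s, x)) 1 + Finsupp.single (c (t, y)) 1)) :
    u = Finsupp.single (c (s, x)) 1 + Finsupp.single (c (t, y)) 1 := by
  obtain ⟨hdeg, hmoment⟩ := (hA _ _).1 h
  simp only [map_add, cubeMoment_single] at hmoment
  obtain ⟨j⟩ := ‹Nonempty ι›
  obtain ⟨x', hx'⟩ := exists_of_cubeMoment_ne_zero (c := c) (s := s) (j := j) (u := u)
    (by simp [hmoment, hst.symm])
  obtain ⟨y', hy'⟩ := exists_of_cubeMoment_ne_zero (c := c) (s := t) (j := j) (u := u)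
    (by simp [hmoment, hst])
  obtain ⟨r, rfl⟩ := exists_eq_add_single hy'
  have hne : c (s, x') ≠ c (t, y') := by simp [hst]
  rw [Finsupp.add_apply, Finsupp.single_eq_of_ne hne, add_zero] at hx'
  obtain ⟨r, rfl⟩ := exists_eq_add_single hx'
  obtain rfl : r = 0 := (Finsupp.degree_eq_zero_iff r).1 (by simpa using hdeg)
  have hx : x' = x := funext fun k => Units.ext (by
    simpa [cubeMoment_single, hst.symm] using hmoment s k)
  have hy : y' = y := funext fun k => Units.ext (by
    simpa [cubeMoment_single, hst] using hmoment t k)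
  rw [hx, hy, zero_add]

theorem IsTwoCubes.isStandard_mixed [Nonempty ι] (hA : IsTwoCubes A c) (m : MonomialOrder n)
    {s t : ℤˣ} (hst : s ≠ t) (x y : ι → ℤˣ) :
    IsStandard A m (Finsupp.single (c (s, x)) 1 + Finsupp.single (c (t, y)) 1) :=
  fun _ hv => (congrArg m.toSyn (hA.eq_of_multidegree_eq_mixed hst hv)).ge

theorem IsTwoCubes.exists_isStandard_antipodalPair [Finite n] [Nonempty ι] (hA : IsTwoCubes A c)
    (m : MonomialOrder n) : ∃ i, IsStandard A m (antipodalPair c i) := by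
  have := Finite.of_equiv n c.symm
  obtain ⟨i, hi⟩ := Finite.exists_min fun i => m.toSyn (antipodalPair c i)
  refine ⟨i, fun v hv => ?_⟩
  obtain ⟨k, rfl⟩ := hA.eq_antipodalPair hv
  exact hi k

theorem exists_three_ne_sum_eq [Fintype ι] (hι : 3 ≤ Fintype.card ι) (w : ι → ℤˣ) :
    ∃ x y z : ι → ℤˣ, x ≠ w ∧ y ≠ w ∧ z ≠ w ∧ ∀ j, (x j : ℤ) + y j + z j = w j := by
  classical
  obtain ⟨a, b, e, hab, hae, hbe⟩ := Fintype.two_lt_card_iff.1 hι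
  refine ⟨Function.update w a (-w a), Function.update w b (-w b),
    fun j => if j = a ∨ j = b then w j else -w j, ?_, ?_, ?_, fun j => ?_⟩
  · exact fun h => units_ne_neg_self (w a) (by simpa using (congrFun h a).symm)
  · exact fun h => units_ne_neg_self (w b) (by simpa using (congrFun h b).symm)
  · exact fun h => units_ne_neg_self (w e) (by simpa [hae.symm, hbe.symm] using (congrFun h e).symm)
  · rcases eq_or_ne j a with rfl | hja
    · simp [hab]
    · rcases eq_or_ne j b with rfl | hjb <;> simp [*]

theorem lex_lt_single [LinearOrder n] [WellFoundedGT n] {v : n →₀ ℕ} {i : n}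
    (h : ∀ k ≤ i, v k = 0) :
    (MonomialOrder.lex (σ := n)).toSyn v < MonomialOrder.lex.toSyn (Finsupp.single i 1) := by
  rw [MonomialOrder.lex_lt_iff, Finsupp.Lex.lt_iff]
  refine ⟨i, fun k hk => (h k hk.le).trans (Finsupp.single_eq_of_ne hk.ne).symm, ?_⟩
  change v i < Finsupp.single i 1 i
  simp [h i le_rfl]

theorem IsTwoCubes.exists_lex_lt_single_add_antipodalPair [LinearOrder n] [WellFoundedGT n]
    [Fintype ι] (hι : 3 ≤ Fintype.card ι) (hA : IsTwoCubes A c) (s : ℤˣ) {w : ι → ℤˣ}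
    (hw : ∀ x, c (s, w) ≤ c (s, x)) (i : ℤˣ × (ι → ℤˣ)) :
    ∃ v, multidegree A v = multidegree A (Finsupp.single (c (s, w)) 1 + antipodalPair c i) ∧
      MonomialOrder.lex.toSyn v <
        MonomialOrder.lex.toSyn (Finsupp.single (c (s, w)) 1 + antipodalPair c i) := by
  obtain ⟨x, y, z, hx, hy, hz, hsum⟩ := exists_three_ne_sum_eq hι w
  refine ⟨Finsupp.single (c (s, x)) 1 + Finsupp.single (c (s, y)) 1 + Finsupp.single (c (s, z)) 1,
    (hA _ _).2 ⟨by simp [degree_antipodalPair], fun t j => ?_⟩, ?_⟩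
  · simp only [map_add, cubeMoment_single, cubeMoment_antipodalPair, ← hsum]
    split_ifs <;> simp
  · refine (lex_lt_single (i := c (s, w)) fun k hk => ?_).trans_le
      (MonomialOrder.lex.toSyn_monotone le_self_add)
    have hne {p : ι → ℤˣ} (hp : p ≠ w) : k ≠ c (s, p) := by
      rintro rfl
      exact hp (by simpa using (hw p).antisymm' hk)
    simp [Finsupp.single_eq_of_ne (hne hx), Finsupp.single_eq_of_ne (hne hy),
      Finsupp.single_eq_of_ne (hne hz)]

theorem IsTwoCubes.not_hasLexQuadraticGroebnerBasis [Finite n] [Fintype ι]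
    (hι : 3 ≤ Fintype.card ι) (K : Type*) [Field K] (hA : IsTwoCubes A c) :
    ¬ HasLexQuadraticGroebnerBasis (toricIdeal K A) := by
  rintro ⟨_, hB⟩
  have : Nonempty ι := Fintype.card_pos_iff.1 (by omega)
  obtain ⟨⟨s, b⟩, hpair⟩ := hA.exists_isStandard_antipodalPair MonomialOrder.lex
  obtain ⟨w, hw⟩ := Finite.exists_min fun x : ι → ℤˣ => c (-s, x)
  obtain ⟨v, hvA, hlt⟩ := hA.exists_lex_lt_single_add_antipodalPair hι (-s) hw (s, b)
  refine hlt.not_ge (hB.isStandard (fun a ha hdeg => ?_) v hvA)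
  rw [antipodalPair, ← add_assoc] at ha
  rcases le_add_single_of_degree_le_two hdeg ha with hle | hle | hle
  · exact (hA.isStandard_mixed _ (neg_units_ne_self s) _ _).of_le hle
  · exact (hA.isStandard_mixed _ (neg_units_ne_self s) _ _).of_le hle
  · exact hpair.of_le hle

end LexOrder

section Cuts

variable {V : Type*} [Fintype V]

/-- The set of vertices of negative sign; sign vectors encode the sets of vertices. -/
def negativeSet (σ : V → ℤˣ) : Finset V := {v | σ v = -1}

theorem negativeSet_surjective :
    Function.Surjective (negativeSet : (V → ℤˣ) → Finset V) := fun C =>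
  ⟨fun v => open scoped Classical in if v ∈ C then -1 else 1, by
    ext v
    simp only [negativeSet, Finset.mem_filter_univ]
    split_ifs with h <;> simp [h, units_ne_neg_self]⟩

theorem one_sub_two_mul_cutVector_negativeSet [DecidableEq V] {G : SimpleGraph V} (σ : V → ℤˣ)
    {a b : V} (h : s(a, b) ∈ G.edgeSet) :
    1 - 2 * cutVector G (negativeSet σ) ⟨s(a, b), h⟩ = σ a * σ b := by
  have hab : a ≠ b := G.ne_of_adj h
  rw [cutVector, Sym2.toFinset_mk_eq]
  rcases Int.units_eq_one_or (σ a) with ha | ha <;>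
    rcases Int.units_eq_one_or (σ b) with hb | hb <;>
    simp [negativeSet, ha, hb, hab, units_ne_neg_self]

end Cuts

section CompleteBipartite

variable {α β : Type*}

/-- The edge of a complete bipartite graph between `a` and `b`. -/
def bipartiteEdge (a : α) (b : β) : (completeBipartiteGraph α β).edgeSet :=
  ⟨s(Sum.inl a, Sum.inr b), by simp⟩

theorem exists_eq_bipartiteEdge (e : (completeBipartiteGraph α β).edgeSet) :
    ∃ a b, e = bipartiteEdge a b := by
  obtain ⟨e, he⟩ := e
  rw [SimpleGraph.edgeSet_completeBipartiteGraph] at he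
  obtain ⟨⟨a, b⟩, rfl⟩ := he
  exact ⟨a, b, rfl⟩

variable [Fintype α] [Fintype β] [DecidableEq α] [DecidableEq β]

theorem cutVector_negativeSet_eq_iff {σ τ : α ⊕ β → ℤˣ} :
    cutVector (completeBipartiteGraph α β) (negativeSet σ) =
        cutVector (completeBipartiteGraph α β) (negativeSet τ) ↔
      ∀ a b, σ (Sum.inl a) * σ (Sum.inr b) = τ (Sum.inl a) * τ (Sum.inr b) := by
  have hedge (a : α) (b : β) : cutVector _ (negativeSet σ) (bipartiteEdge a b) =
        cutVector _ (negativeSet τ) (bipartiteEdge a b) ↔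
      σ (Sum.inl a) * σ (Sum.inr b) = τ (Sum.inl a) * τ (Sum.inr b) := by
    rw [Units.ext_iff, Units.val_mul, Units.val_mul,
      ← one_sub_two_mul_cutVector_negativeSet σ (bipartiteEdge a b).2,
      ← one_sub_two_mul_cutVector_negativeSet τ (bipartiteEdge a b).2]
    simp [bipartiteEdge]
  refine ⟨fun h a b => (hedge a b).1 (congrFun h _), fun h => funext fun e => ?_⟩
  obtain ⟨a, b, rfl⟩ := exists_eq_bipartiteEdge e
  exact (hedge a b).2 (h a b)

end CompleteBipartite

section CompleteBipartiteTwo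

variable {ι : Type*} [Fintype ι] [DecidableEq ι]

/-- The cut vector of `K_{2,ι}` given by a vertex of the two cubes. Up to a global sign, the first
of the two vertices on the small side has sign `1`; then `s` is the sign of the other one, and `x`
lists the signs on the other side. -/
def cubeCut (i : ℤˣ × (ι → ℤˣ)) : Set.range (cutVector (completeBipartiteGraph (Fin 2) ι)) :=
  ⟨cutVector _ (negativeSet (Sum.elim ![1, i.1] i.2)), Set.mem_range_self _⟩

theorem cubeCut_eq_iff {i k : ℤˣ × (ι → ℤˣ)} :
    cubeCut i = cubeCut k ↔ i.2 = k.2 ∧ ∀ j, i.1 * i.2 j = k.1 * k.2 j := by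
  rw [cubeCut, cubeCut, Subtype.mk.injEq, cutVector_negativeSet_eq_iff, Fin.forall_fin_two,
    funext_iff]
  simp

theorem cubeCut_injective [Nonempty ι] : Function.Injective (cubeCut (ι := ι)) := by
  rintro ⟨s, x⟩ ⟨t, y⟩ h
  obtain ⟨hxy, hst⟩ := cubeCut_eq_iff.1 h
  obtain rfl : x = y := hxy
  exact congrArg (·, x) (mul_right_cancel (hst (Classical.arbitrary ι)))

theorem cubeCut_surjective : Function.Surjective (cubeCut (ι := ι)) := by
  rintro ⟨_, C, rfl⟩
  obtain ⟨σ, rfl⟩ := negativeSet_surjective C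
  refine ⟨(σ (Sum.inl 0) * σ (Sum.inl 1), fun j => σ (Sum.inl 0) * σ (Sum.inr j)),
    Subtype.ext (cutVector_negativeSet_eq_iff.2 fun a j => ?_)⟩
  fin_cases a
  · simp
  · simp [mul_mul_mul_comm _ _ (σ (Sum.inl 0))]

/-- The cuts of `K_{2,ι}` correspond to the vertices of two cubes. -/
noncomputable def cutEquiv [Nonempty ι] :
    ℤˣ × (ι → ℤˣ) ≃ Set.range (cutVector (completeBipartiteGraph (Fin 2) ι)) :=
  Equiv.ofBijective cubeCut ⟨cubeCut_injective, cubeCut_surjective⟩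

theorem multidegree_cutMatrix_inr {V : Type*} [DecidableEq V] {G : SimpleGraph V}
    (u : Set.range (cutVector G) →₀ ℕ) :
    multidegree (cutMatrix G) u (Sum.inr ()) = u.degree := by
  rw [multidegree_apply, Finsupp.weight_apply, Finsupp.degree_apply]
  simp [Finsupp.sum, cutMatrix]

theorem degree_sub_two_mul_multidegree [Nonempty ι]
    (u : Set.range (cutVector (completeBipartiteGraph (Fin 2) ι)) →₀ ℕ) (a : Fin 2) (j : ι) :
    u.degree - 2 * multidegree (cutMatrix _) u (Sum.inl (bipartiteEdge a j)) =
      cubeMoment cutEquiv 1 j u + ![1, -1] a * cubeMoment cutEquiv (-1) j u := by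
  have h : (Nat.castAddMonoidHom ℤ).comp Finsupp.degree - (AddMonoidHom.mulLeft (2 : ℤ)).comp
        ((Pi.evalAddMonoidHom _ (Sum.inl (bipartiteEdge a j))).comp (multidegree (cutMatrix _))) =
      cubeMoment cutEquiv 1 j +
        (AddMonoidHom.mulLeft (![1, -1] a : ℤ)).comp (cubeMoment cutEquiv (-1) j) := by
    refine Finsupp.addHom_ext' fun k => AddMonoidHom.ext_nat ?_
    obtain ⟨⟨s, x⟩, rfl⟩ := cutEquiv.surjective k
    have hcut : 1 - 2 * multidegree (cutMatrix _) (Finsupp.single (cutEquiv (s, x)) 1)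
        (Sum.inl (bipartiteEdge a j)) = ![1, s] a * x j := by
      rw [multidegree_apply, Finsupp.weight_single, one_smul]
      exact one_sub_two_mul_cutVector_negativeSet (Sum.elim ![1, s] x) (bipartiteEdge a j).2
    fin_cases a <;> rcases Int.units_eq_one_or s with rfl | rfl <;>
      simpa [cubeMoment_single] using hcut
  exact DFunLike.congr_fun h u

theorem isTwoCubes_cutMatrix [Nonempty ι] :
    IsTwoCubes (cutMatrix (completeBipartiteGraph (Fin 2) ι)) cutEquiv := by
  intro u v
  have hu := degree_sub_two_mul_multidegree u
  have hv := degree_sub_two_mul_multidegree v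
  simp only [Fin.forall_fin_two, Matrix.cons_val_zero, Matrix.cons_val_one] at hu hv
  constructor
  · intro h
    have hdeg : (u.degree : ℤ) = v.degree := by
      rw [← multidegree_cutMatrix_inr, h, multidegree_cutMatrix_inr]
    refine ⟨Nat.cast_injective hdeg, fun s j => ?_⟩
    rw [h, hdeg] at hu
    have := hu.1 j
    have := hu.2 j
    have := hv.1 j
    have := hv.2 j
    rcases Int.units_eq_one_or s with rfl | rfl <;> omega
  · rintro ⟨hdeg, hmoment⟩
    funext r
    rcases r with e | ⟨⟩
    · obtain ⟨a, j, rfl⟩ := exists_eq_bipartiteEdge e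
      have hu := degree_sub_two_mul_multidegree u a j
      have hv := degree_sub_two_mul_multidegree v a j
      rw [hdeg, hmoment, hmoment] at hu
      omega
    · rw [multidegree_cutMatrix_inr, multidegree_cutMatrix_inr, hdeg]

end CompleteBipartiteTwo

end CutIdeal

theorem mainTheorem3_general (K : Type*) [Field K] (ι : Type*) [Fintype ι] [DecidableEq ι]
    (hι : 3 ≤ Fintype.card ι) :
    CutIdeal.IsGeneratedByQuadraticBinomials
        (CutIdeal.cutIdeal K (completeBipartiteGraph (Fin 2) ι)) ∧
      ¬ CutIdeal.HasLexQuadraticGroebnerBasis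
        (CutIdeal.cutIdeal K (completeBipartiteGraph (Fin 2) ι)) := by
  have : Nonempty ι := Fintype.card_pos_iff.1 (by omega)
  have hcubes := CutIdeal.isTwoCubes_cutMatrix (ι := ι)
  exact ⟨hcubes.isGeneratedByQuadraticBinomials K, hcubes.not_hasLexQuadraticGroebnerBasis hι K⟩

theorem mainTheorem3 (K : Type*) [Field K] :
    CutIdeal.IsGeneratedByQuadraticBinomials
        (CutIdeal.cutIdeal K (completeBipartiteGraph (Fin 2) (Fin 3))) ∧
      ¬ CutIdeal.HasLexQuadraticGroebnerBasis
        (CutIdeal.cutIdeal K (completeBipartiteGraph (Fin 2) (Fin 3))) :=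
  mainTheorem3_general K (Fin 3) (by simp)
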